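/- Let $\Omega\subset\mathbb{R}^d$ be open and bounded, let $\alpha>0$, $c\in\mathbb{R}$ and $y^d\in L^2(\Omega)$. For $x\in\Omega$ and $z\in\mathbb{R}$ put \[ \partial f^*(x,z)=\begin{cases}\{c\}, & z>\alpha^{-1}(c-y^d(x)),\\ \{\alpha z+y^d(x)\}, & z\le\alpha^{-1}(c-y^d(x))\end{cases} \] (this is the convex subdifferential at $z$ of $f^*(x,\cdot)$, $f^*(x,z)=\sup_{s\le c}\,\bigl(sz-\tfrac1{2\alpha}|s-y^d(x)|^2\bigr)$), and for $v\in L^2(\Omega)$ \[ \partial F^*(v):=\{\eta\in L^2(\Omega)\mid \eta(x)\in\partial f^*(x,v(x))\text{ for a.e. }x\in\Omega\}. \] Notation. Let $R:Q\rightrightarrows W$ be a set-valued map between real Hilbert spaces. For $U\subset Q\times W$, the set $\widehat N(p;U)$ consists of all $z$ with $\limsup_{U\ni p'\to p,\,p'\neq p}\langle z,p'-p\rangle/\|p'-p\|\le 0$ if $p\in U$, and is empty if $p\notin U$; $T(p;U)$ is the set of all limits $\lim_i (p^i-p)/\tau^i$ with $p^i\in U$, $\tau^i>0$, $\tau^i\to0$.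 The graphical derivative is $DR(q|w)(\Delta q)=\{\Delta w\mid(\Delta q,\Delta w)\in T((q,w);\operatorname{graph}R)\}$; its convexification $\widetilde{DR}(q|w)$ is the map whose graph is the convex hull of $\operatorname{graph}[DR(q|w)]$; the regular coderivative is $\widehat D^*R(q|w)(\Delta w)=\{\Delta q\mid(\Delta q,-\Delta w)\in\widehat N((q,w);\operatorname{graph}R)\}$. The polar of $V\subset L^2(\Omega)$ is $V^\circ=\{z\mid\langle z,z'\rangle\le0\ \text{for all }z'\in V\}$. Let $v,\eta\in L^2(\Omega)$ and suppose strict complementarity: $\alpha v(x)\neq c-y^d(x)$ for a.e. $x\in\Omega$. Then for all $\Delta v,\Delta\eta\in L^2(\Omega)$ \[ \widetilde{D[\partial F^*]}(v|\eta)(\Delta v)=\begin{cases}T_v\Delta v+V[v|\eta]^\circ, & \Delta v\in V[v|\eta]\text{ and }\eta\in\partial F^*(v),\\ \emptyset, & \text{otherwise,}\end{cases} \] \[ \widehat D^*[\partial F^*](v|\eta)(\Delta\eta)=\begin{cases}T_v^*\Delta\eta+V[v|\eta]^\circ, & -\Delta\eta\in V[v|\eta]\text{ and }\eta\in\partial F^*(v),\\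 \emptyset, & \text{otherwise,}\end{cases} \] for the cone $V[v|\eta]=L^2(\Omega)$ with polar $V[v|\eta]^\circ=\{0\}\subset L^2(\Omega)$, where $T_v:L^2(\Omega)\to L^2(\Omega)$ is the bounded linear operator $[T_vh](x)=t_v(x)h(x)$ with \[ t_v(x)=\begin{cases}0, & \alpha v(x)>c-y^d(x),\\ \alpha, & \alpha v(x)<c-y^d(x),\end{cases} \] and $T_v^*$ is its Hilbert space adjoint. -/

import Mathlib

open MeasureTheory Filter Topology
open scoped Pointwise

noncomputable section

/-! ### Set-valued analysis in Hilbert spaces -/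

/-- The set of Fréchet (regular) normals to `U` at `u`; as usual it is empty if `u ∉ U`.
The upper limit is taken in the extended reals, over `u' ∈ U`, `u' ≠ u`, `u' → u`. -/
def frechetNormals {X : Type*} [NormedAddCommGroup X] [InnerProductSpace ℝ X]
    (U : Set X) (u : X) : Set X :=
  {z | u ∈ U ∧
    limsup (fun u' : X => ((inner ℝ z (u' - u) / ‖u' - u‖ : ℝ) : EReal)) (𝓝[U \ {u}] u) ≤ 0}

/-- The set of tangent vectors (Bouligand tangent cone) to `U` at `u`: all limits of
`(uᵢ - u) / τᵢ` with `uᵢ ∈ U`, `τᵢ > 0` and `τᵢ → 0`. -/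
def tangentVectors {X : Type*} [NormedAddCommGroup X] [InnerProductSpace ℝ X]
    (U : Set X) (u : X) : Set X :=
  {z | ∃ (τ : ℕ → ℝ) (w : ℕ → X), (∀ i, 0 < τ i) ∧ Tendsto τ atTop (𝓝 0) ∧ (∀ i, w i ∈ U) ∧
    Tendsto (fun i => (τ i)⁻¹ • (w i - u)) atTop (𝓝 z)}

/-- The polar cone of `V`. -/
def polarCone {X : Type*} [NormedAddCommGroup X] [InnerProductSpace ℝ X] (V : Set X) : Set X :=
  {z | ∀ z' ∈ V, inner ℝ z z' ≤ 0}

/-- The graph of a set-valued map `R : Q ⇉ W`, in the Hilbert space product of `Q` and `W`. -/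
def setValuedGraph {Q W : Type*} (R : Q → Set W) : Set (WithLp 2 (Q × W)) :=
  {p | p.snd ∈ R p.fst}

section Derivatives

variable {Q W : Type*} [NormedAddCommGroup Q] [InnerProductSpace ℝ Q]
  [NormedAddCommGroup W] [InnerProductSpace ℝ W]

/-- The graphical derivative `D R(q|w) : Q ⇉ W`. -/
def graphicalDerivative (R : Q → Set W) (q : Q) (w : W) : Q → Set W :=
  fun dq => {dw | WithLp.toLp 2 (dq, dw) ∈ tangentVectors (setValuedGraph R) (WithLp.toLp 2 (q, w))}

/-- The convexified graphical derivative: the set-valued map whose graph is the convex hull of the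
graph of `D R(q|w)`. -/
def convexifiedGraphicalDerivative (R : Q → Set W) (q : Q) (w : W) : Q → Set W :=
  fun dq => {dw | WithLp.toLp 2 (dq, dw) ∈
    convexHull ℝ (setValuedGraph (graphicalDerivative R q w))}

/-- The regular (Fréchet) coderivative of `R` at `q` for `w`, a set-valued map `W ⇉ Q`. -/
def regularCoderivative (R : Q → Set W) (q : Q) (w : W) : W → Set Q :=
  fun dw => {dq | WithLp.toLp 2 (dq, -dw) ∈ frechetNormals (setValuedGraph R) (WithLp.toLp 2 (q, w))}

end Derivatives

/-! ### The state constraint functional -/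

/-- The Fenchel conjugate `z ↦ sup_{v ≤ c} (v z - |v - y|² / (2α))` of the pointwise integrand
`v ↦ |v - y|² / (2α) + ι_{(-∞, c]}(v)`; for `α > 0` the supremum is finite. -/
def stateConj (α c y z : ℝ) : ℝ :=
  sSup ((fun v : ℝ => v * z - (v - y) ^ 2 / (2 * α)) '' Set.Iic c)

/-- The pointwise subdifferential `∂f*(x, z)`, with `y` standing for `y^d(x)`. -/
def stateSubdiff (α c y z : ℝ) : Set ℝ :=
  if α⁻¹ * (c - y) < z then {c} else {α * z + y}

theorem stateSubdiff_eq_min {α : ℝ} (hα : 0 < α) (c y z : ℝ) :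
    stateSubdiff α c y z = {min c (α * z + y)} := by
  have key : α⁻¹ * (c - y) < z ↔ c - y < α * z := by
    rw [inv_mul_lt_iff₀ hα]
  unfold stateSubdiff
  split_ifs with h
  · rw [key] at h
    rw [min_eq_left (by linarith)]
  · rw [key] at h
    rw [min_eq_right (by linarith)]

theorem isGreatest_stateConj {α : ℝ} (hα : 0 < α) (c y z : ℝ) :
    IsGreatest ((fun v : ℝ => v * z - (v - y) ^ 2 / (2 * α)) '' Set.Iic c)
      (min c (α * z + y) * z - (min c (α * z + y) - y) ^ 2 / (2 * α)) := by
  refine ⟨⟨_, Set.mem_Iic.2 (min_le_left _ _), rfl⟩, ?_⟩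
  rintro _ ⟨v, hv, rfl⟩
  have hv : v ≤ c := hv
  set m := min c (α * z + y) with hm
  have h1 : 0 ≤ (v - m) * (v + m - 2 * y - 2 * α * z) := by
    rcases le_total c (α * z + y) with h | h
    · rw [min_eq_left h] at hm
      rw [hm]
      nlinarith
    · rw [min_eq_right h] at hm
      rw [hm]
      nlinarith [sq_nonneg (v - (α * z + y))]
  have h2 : m * z - (m - y) ^ 2 / (2 * α) - (v * z - (v - y) ^ 2 / (2 * α))
      = (v - m) * (v + m - 2 * y - 2 * α * z) / (2 * α) := by
    field_simp
    ring
  have h3 : 0 ≤ (v - m) * (v + m - 2 * y - 2 * α * z) / (2 * α) := by positivity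
  show v * z - (v - y) ^ 2 / (2 * α) ≤ _
  linarith

/-- `stateSubdiff` is the convex subdifferential of the conjugate integrand. -/
theorem stateSubdiff_eq {α : ℝ} (hα : 0 < α) (c y z : ℝ) :
    stateSubdiff α c y z =
      {ζ | ∀ w : ℝ, stateConj α c y z + ζ * (w - z) ≤ stateConj α c y w} := by
  have val : ∀ z, stateConj α c y z =
      min c (α * z + y) * z - (min c (α * z + y) - y) ^ 2 / (2 * α) :=
    fun z => (isGreatest_stateConj hα c y z).csSup_eq
  have sub : ∀ z w, stateConj α c y z + min c (α * z + y) * (w - z) ≤ stateConj α c y w := by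
    intro z w
    have h := (isGreatest_stateConj hα c y w).2 ⟨min c (α * z + y), Set.mem_Iic.2 (min_le_left _ _), rfl⟩
    rw [val z, val w]
    simp only at h
    linarith
  have cont : Continuous fun w : ℝ => min c (α * w + y) := by fun_prop
  rw [stateSubdiff_eq_min hα]
  ext ζ
  simp only [Set.mem_singleton_iff, Set.mem_ofPred_eq]
  constructor
  · rintro rfl w
    exact sub z w
  · intro h
    apply le_antisymm
    · have hc : Tendsto (fun w : ℝ => min c (α * w + y)) (𝓝[>] z) (𝓝 (min c (α * z + y))) :=
        (cont.tendsto z).mono_left nhdsWithin_le_nhds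
      refine ge_of_tendsto hc ?_
      filter_upwards [self_mem_nhdsWithin] with w hw
      have hw : z < w := hw
      have h1 := h w
      have h2 := sub w z
      nlinarith
    · have hc : Tendsto (fun w : ℝ => min c (α * w + y)) (𝓝[<] z) (𝓝 (min c (α * z + y))) :=
        (cont.tendsto z).mono_left nhdsWithin_le_nhds
      refine le_of_tendsto hc ?_
      filter_upwards [self_mem_nhdsWithin] with w hw
      have hw : w < z := hw
      have h1 := h w
      have h2 := sub w z
      nlinarith

/-- The real Hilbert space `L²(Ω)`. -/
abbrev L2 {d : ℕ} (Ω : Set (EuclideanSpace ℝ (Fin d))) : Type :=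
  Lp ℝ 2 ((volume : Measure (EuclideanSpace ℝ (Fin d))).restrict Ω)

section StateConstraints

variable {d : ℕ} {Ω : Set (EuclideanSpace ℝ (Fin d))}

/-- `∂F*(v)`: the set of all `η ∈ L²(Ω)` with `η(x) ∈ ∂f*(x, v(x))` for a.e. `x ∈ Ω`. -/
def integralSubdiff (α c : ℝ) (yd : L2 Ω) (v : L2 Ω) : Set (L2 Ω) :=
  {η | ∀ᵐ x ∂(volume.restrict Ω), η x ∈ stateSubdiff α c (yd x) (v x)}

/-- The function `t_v`: `0` where `α v(x) > c - y^d(x)` and `α` where `α v(x) < c - y^d(x)`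
(also `α` on the set of equality, which will be a null set). -/
def multiplierFun (α c : ℝ) (yd v : L2 Ω) (x : EuclideanSpace ℝ (Fin d)) : ℝ :=
  if c - yd x < α * v x then 0 else α

theorem measurable_multiplierFun (α c : ℝ) (yd v : L2 Ω) :
    Measurable (multiplierFun α c yd v) := by
  refine Measurable.ite (measurableSet_lt ?_ ?_) measurable_const measurable_const
  · exact measurable_const.sub (Lp.stronglyMeasurable yd).measurable
  · exact measurable_const.mul (Lp.stronglyMeasurable v).measurable

theorem norm_multiplierFun_le (α c : ℝ) (yd v : L2 Ω) (x : EuclideanSpace ℝ (Fin d)) :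
    ‖multiplierFun α c yd v x‖ ≤ |α| := by
  unfold multiplierFun
  split_ifs <;> simp

theorem memLp_multiplier_mul (α c : ℝ) (yd v h : L2 Ω) :
    MemLp (fun x => multiplierFun α c yd v x * h x) 2 (volume.restrict Ω) := by
  refine (Lp.memLp h).of_le_mul (c := |α|)
    ((measurable_multiplierFun α c yd v).aestronglyMeasurable.mul
      (Lp.stronglyMeasurable h).aestronglyMeasurable) (Eventually.of_forall fun x => ?_)
  rw [norm_mul]
  exact mul_le_mul_of_nonneg_right (norm_multiplierFun_le α c yd v x) (norm_nonneg _)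

/-- The bounded linear operator `T_v` on `L²(Ω)`, `[T_v h](x) = t_v(x) h(x)`. -/
def multiplierOp (α c : ℝ) (yd v : L2 Ω) : L2 Ω →L[ℝ] L2 Ω :=
  LinearMap.mkContinuous
    { toFun := fun h => (memLp_multiplier_mul α c yd v h).toLp
        (fun x => multiplierFun α c yd v x * h x)
      map_add' := by
        intro h k
        rw [← MemLp.toLp_add, MemLp.toLp_eq_toLp_iff]
        filter_upwards [Lp.coeFn_add h k] with x hx
        simp only [hx, Pi.add_apply, mul_add]
      map_smul' := by
        intro a h
        rw [RingHom.id_apply, ← MemLp.toLp_const_smul, MemLp.toLp_eq_toLp_iff]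
        filter_upwards [Lp.coeFn_smul a h] with x hx
        simp only [hx, Pi.smul_apply, smul_eq_mul]
        ring }
    |α| (by
      intro h
      refine Lp.norm_le_mul_norm_of_ae_le_mul ?_
      filter_upwards [(memLp_multiplier_mul α c yd v h).coeFn_toLp] with x hx
      simp only [LinearMap.coe_mk, AddHom.coe_mk]
      rw [hx, norm_mul]
      exact mul_le_mul_of_nonneg_right (norm_multiplierFun_le α c yd v x) (norm_nonneg _))

/-- The cone `V[v|η]`, which under strict complementarity is the whole space `L²(Ω)`. -/
def derivCone (_v _η : L2 Ω) : Set (L2 Ω) := Set.univ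

end StateConstraints

end

/-! ### Normals and tangents in a Hilbert space. -/

section HilbertSpace

variable {X : Type*} [NormedAddCommGroup X] [InnerProductSpace ℝ X]

/-! The subdifferential is single-valued: `integralSubdiff` is the superposition operator S(v) =
min(c, αv + y^d). On L² such an operator is in general not Fréchet differentiable, but two weaker
properties suffice. Strong directional differentiability makes every (h, Th) tangent to the graph.
An o(‖h‖) remainder against each fixed g makes every (T*g, -g) a regular normal. Normals are polar
to tangents, so these two families determine each other: the tangent cone is exactly the graph of T,
already convex, and the normals are exactly the pairs (T*g, -g). Both properties rest on one
observation. With slack m = αv - (c - y^d), the remainder is bounded by α|h| and vanishes where α|h|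
< |m|. Restricting a fixed g to {|m| ≤ α|h|} gives an element tending to 0 in L² as h → 0, because m
≠ 0 a.e. (`tendsto_cutoff`). -/

theorem mem_frechetNormals_iff {U : Set X} {u z : X} :
    z ∈ frechetNormals U u ↔
      u ∈ U ∧ ∀ ε > 0, ∀ᶠ u' in 𝓝[U] u, inner ℝ z (u' - u) ≤ ε * ‖u' - u‖ := by
  refine and_congr_right fun _ => ?_
  rw [limsup_le_iff']
  constructor
  · intro h ε hε
    have h1 := h (ε : EReal) (by exact_mod_cast hε)
    rw [eventually_nhdsWithin_iff] at h1 ⊢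
    filter_upwards [h1] with u' hu' hU
    by_cases hne : u' = u
    · simp [hne]
    · have h2 := EReal.coe_le_coe_iff.1 (hu' ⟨hU, hne⟩)
      rwa [div_le_iff₀ (norm_pos_iff.2 (sub_ne_zero.2 hne))] at h2
  · intro h y hy
    -- The extended real `y` may be `⊤`, so a real bound is interposed.
    obtain ⟨ε, hε, hεy⟩ := EReal.lt_iff_exists_real_btwn.1 hy
    have h1 := h ε (by exact_mod_cast hε)
    rw [eventually_nhdsWithin_iff] at h1 ⊢
    filter_upwards [h1] with u' hu' hU
    refine le_trans (EReal.coe_le_coe_iff.2 ?_) hεy.le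
    rw [div_le_iff₀ (norm_pos_iff.2 (sub_ne_zero.2 hU.2))]
    exact hu' hU.1

theorem tendsto_of_tendsto_inv_smul_sub {τ : ℕ → ℝ} {w : ℕ → X} {u z : X} (hτ : ∀ i, 0 < τ i)
    (hτ0 : Tendsto τ atTop (𝓝 0)) (hw : Tendsto (fun i => (τ i)⁻¹ • (w i - u)) atTop (𝓝 z)) :
    Tendsto w atTop (𝓝 u) := by
  have h := (hτ0.smul hw).add_const u
  rw [zero_smul, zero_add] at h
  refine h.congr fun i => ?_
  rw [smul_inv_smul₀ (hτ i).ne', sub_add_cancel]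

theorem mem_closure_of_mem_tangentVectors {U : Set X} {u z : X} (hz : z ∈ tangentVectors U u) :
    u ∈ closure U := by
  obtain ⟨τ, w, hτ, hτ0, hwU, hw⟩ := hz
  exact mem_closure_of_tendsto (tendsto_of_tendsto_inv_smul_sub hτ hτ0 hw) (Eventually.of_forall hwU)

/-- Dividing the normal inequality along a sequence generating the tangent by τᵢ gives ⟨z, z'⟩ ≤
ε‖z'‖ in the limit; then ε → 0. -/
theorem frechetNormals_subset_polarCone_tangentVectors (U : Set X) (u : X) :
    frechetNormals U u ⊆ polarCone (tangentVectors U u) := by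
  intro z hz z' hz'
  obtain ⟨τ, w, hτ, hτ0, hwU, hw⟩ := hz'
  have hwu : Tendsto w atTop (𝓝[U] u) :=
    tendsto_nhdsWithin_iff.2
      ⟨tendsto_of_tendsto_inv_smul_sub hτ hτ0 hw, Eventually.of_forall hwU⟩
  have key : ∀ ε > 0, inner ℝ z z' ≤ ε * ‖z'‖ := by
    intro ε hε
    refine le_of_tendsto_of_tendsto (tendsto_const_nhds.inner hw) (hw.norm.const_mul ε) ?_
    filter_upwards [hwu.eventually ((mem_frechetNormals_iff.1 hz).2 ε hε)] with i hi
    rw [real_inner_smul_right, norm_smul, norm_inv, Real.norm_of_nonneg (hτ i).le]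
    have := mul_le_mul_of_nonneg_left hi (inv_pos.2 (hτ i)).le
    linarith
  have hlim : Tendsto (fun ε : ℝ => ε * ‖z'‖) (𝓝[>] 0) (𝓝 0) := by
    have h : Tendsto (fun ε : ℝ => ε * ‖z'‖) (𝓝 0) (𝓝 (0 * ‖z'‖)) :=
      tendsto_id.mul_const _
    rw [zero_mul] at h
    exact h.mono_left nhdsWithin_le_nhds
  exact ge_of_tendsto hlim (eventually_mem_nhdsWithin.mono key)

theorem polarCone_univ : polarCone (Set.univ : Set X) = {0} := by
  ext z
  refine ⟨fun h => ?_, ?_⟩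
  · exact real_inner_self_nonpos.1 (h z (Set.mem_univ z))
  · rintro rfl z' -
    simp

end HilbertSpace

/-! ### Generalized derivatives of a single-valued map. -/

section SingleValued

variable {Q W : Type*} [NormedAddCommGroup Q] [InnerProductSpace ℝ Q]
  [NormedAddCommGroup W] [InnerProductSpace ℝ W]

theorem isClosed_setValuedGraph_singleton {S : Q → W} (hS : Continuous S) :
    IsClosed (setValuedGraph fun q => {S q}) := by
  have h : setValuedGraph (fun q => {S q}) = {p : WithLp 2 (Q × W) | p.snd = S p.fst} := rfl
  rw [h]
  exact isClosed_eq (WithLp.sndL 2 ℝ Q W).continuous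
    (hS.comp (WithLp.fstL 2 ℝ Q W).continuous)

/-- The tangent definition does not require the base point to lie in the set; closedness of the
graph supplies this. -/
theorem convexifiedGraphicalDerivative_eq_empty {R : Q → Set W} {q : Q} {w : W}
    (hR : IsClosed (setValuedGraph R)) (hw : w ∉ R q) (h : Q) :
    convexifiedGraphicalDerivative R q w h = ∅ := by
  have h1 : setValuedGraph (graphicalDerivative R q w) = ∅ := by
    refine Set.eq_empty_of_forall_notMem fun p hp => hw ?_
    have h2 := mem_closure_of_mem_tangentVectors hp
    rw [hR.closure_eq] at h2
    exact h2
  unfold convexifiedGraphicalDerivative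
  rw [h1, convexHull_empty]
  rfl

theorem regularCoderivative_eq_empty {R : Q → Set W} {q : Q} {w : W} (hw : w ∉ R q) (g : W) :
    regularCoderivative R q w g = ∅ :=
  Set.eq_empty_of_forall_notMem fun _ hz => hw hz.1

theorem mem_tangentVectors_of_directionalDeriv {S : Q → W} {T : Q →L[ℝ] W} {q : Q}
    (hdir : ∀ h : Q, Tendsto (fun t : ℝ => t⁻¹ • (S (q + t • h) - S q)) (𝓝[>] 0) (𝓝 (T h)))
    (h : Q) :
    WithLp.toLp 2 (h, T h) ∈
      tangentVectors (setValuedGraph fun q => {S q}) (WithLp.toLp 2 (q, S q)) := by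
  have hτ : ∀ i : ℕ, (0 : ℝ) < 1 / ((i : ℝ) + 1) := fun i => by positivity
  have hτ0 := tendsto_one_div_add_atTop_nhds_zero_nat (𝕜 := ℝ)
  refine ⟨fun i => 1 / ((i : ℝ) + 1),
    fun i => WithLp.toLp 2 (q + (1 / ((i : ℝ) + 1)) • h, S (q + (1 / ((i : ℝ) + 1)) • h)),
    hτ, hτ0, fun i => rfl, ?_⟩
  have h1 := (hdir h).comp (tendsto_nhdsWithin_iff.2 ⟨hτ0, Eventually.of_forall hτ⟩)
  have h2 := ((WithLp.prod_continuous_toLp 2 Q W).tendsto (h, T h)).comp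
    ((tendsto_const_nhds (x := h)).prodMk_nhds h1)
  refine h2.congr fun i => ?_
  simp only [Function.comp_apply, ← WithLp.toLp_sub, ← WithLp.toLp_smul, Prod.mk_sub_mk,
    Prod.smul_mk, add_sub_cancel_left]
  rw [inv_smul_smul₀ (hτ i).ne']

variable [CompleteSpace Q] [CompleteSpace W]

/-- Differentiability tested against a fixed vector of the target space yields regular normals. -/
theorem adjoint_mem_frechetNormals {S : Q → W} {T : Q →L[ℝ] W} {q : Q} {g : W}
    (hg : ∀ ε > 0, ∀ᶠ h in 𝓝 (0 : Q), |inner ℝ g (S (q + h) - S q - T h)| ≤ ε * ‖h‖) :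
    WithLp.toLp 2 (ContinuousLinearMap.adjoint T g, -g) ∈
      frechetNormals (setValuedGraph fun q => {S q}) (WithLp.toLp 2 (q, S q)) := by
  refine mem_frechetNormals_iff.2 ⟨rfl, fun ε hε => ?_⟩
  have hlim : Tendsto (fun p : WithLp 2 (Q × W) => p.fst - q) (𝓝 (WithLp.toLp 2 (q, S q)))
      (𝓝 0) := by
    have h := ((WithLp.fstL 2 ℝ Q W).continuous.sub continuous_const).tendsto
      (WithLp.toLp 2 (q, S q)) (f := fun p => WithLp.fstL 2 ℝ Q W p - q)
    simpa using h
  rw [eventually_nhdsWithin_iff]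
  filter_upwards [hlim.eventually (hg ε hε)] with p hp hpU
  have hp2 : p.snd = S p.fst := hpU
  rw [add_sub_cancel, ← hp2, inner_sub_right, ← ContinuousLinearMap.adjoint_inner_left] at hp
  have hle : ‖p.fst - q‖ ≤ ‖p - WithLp.toLp 2 (q, S q)‖ :=
    WithLp.norm_fst_le _ (p - WithLp.toLp 2 (q, S q))
  have h1 : inner ℝ (WithLp.toLp 2 (ContinuousLinearMap.adjoint T g, -g))
      (p - WithLp.toLp 2 (q, S q)) =
      inner ℝ (ContinuousLinearMap.adjoint T g) (p.fst - q) - inner ℝ g (p.snd - S q) := by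
    simp [WithLp.prod_inner_apply, sub_eq_add_neg]
  rw [h1]
  have h2 := (abs_le.1 hp).1
  have h3 := mul_le_mul_of_nonneg_left hle hε.le
  linarith

variable {S : Q → W} {T : Q →L[ℝ] W} {q : Q}
  (hweak : ∀ g : W, ∀ ε > 0, ∀ᶠ h in 𝓝 (0 : Q), |inner ℝ g (S (q + h) - S q - T h)| ≤ ε * ‖h‖)
  (hdir : ∀ h : Q, Tendsto (fun t : ℝ => t⁻¹ • (S (q + t • h) - S q)) (𝓝[>] 0) (𝓝 (T h)))

include hweak hdir in
theorem graphicalDerivative_singleton (h : Q) :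
    graphicalDerivative (fun q => {S q}) q (S q) h = {T h} := by
  ext k
  refine ⟨fun hk => ?_, ?_⟩
  · have h1 : ∀ g : W, inner ℝ g (T h - k) ≤ 0 := by
      intro g
      -- Pairing the tangent (h, k) with the normal (T*g, -g) gives ⟨g, Th - k⟩ ≤ 0; below, g = Th -
      -- k.
      have h2 := frechetNormals_subset_polarCone_tangentVectors _ _
        (adjoint_mem_frechetNormals (hweak g)) _ hk
      simp only [WithLp.prod_inner_apply, ContinuousLinearMap.adjoint_inner_left,
        inner_neg_left] at h2
      rw [inner_sub_right]
      linarith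
    have h3 := real_inner_self_nonpos.1 (h1 (T h - k))
    exact (sub_eq_zero.1 h3).symm
  · rintro rfl
    exact mem_tangentVectors_of_directionalDeriv hdir h

include hweak hdir in
theorem convexifiedGraphicalDerivative_singleton (h : Q) :
    convexifiedGraphicalDerivative (fun q => {S q}) q (S q) h = {T h} := by
  have h1 : graphicalDerivative (fun q => {S q}) q (S q) = fun h => {T h} :=
    funext (graphicalDerivative_singleton hweak hdir)
  have h2 : Convex ℝ (setValuedGraph fun h => {T h}) := by
    intro x hx y hy a b _ _ _
    have hx : x.snd = T x.fst := hx
    have hy : y.snd = T y.fst := hy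
    show (a • x + b • y).snd = T (a • x + b • y).fst
    simp [hx, hy]
  unfold convexifiedGraphicalDerivative
  rw [h1, h2.convexHull_eq]
  rfl

include hweak hdir in
-- The dual argument: a normal (z, -g) is tested against the tangents (h, Th), with h = z - T*g.
theorem regularCoderivative_singleton (g : W) :
    regularCoderivative (fun q => {S q}) q (S q) g = {ContinuousLinearMap.adjoint T g} := by
  ext z
  refine ⟨fun hz => ?_, ?_⟩
  · have h1 : ∀ h : Q, inner ℝ (z - ContinuousLinearMap.adjoint T g) h ≤ 0 := by
      intro h
      have h2 := frechetNormals_subset_polarCone_tangentVectors _ _ hz _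
        (mem_tangentVectors_of_directionalDeriv hdir h)
      simp only [WithLp.prod_inner_apply, inner_neg_left] at h2
      rw [inner_sub_left, ContinuousLinearMap.adjoint_inner_left]
      linarith
    exact sub_eq_zero.1 (real_inner_self_nonpos.1 (h1 _))
  · rintro rfl
    exact adjoint_mem_frechetNormals (hweak g)

end SingleValued
-- Vanishing of cutoffs in L².
section Cutoff

variable {X : Type*} [MeasurableSpace X] {μ : Measure X}

theorem measurableSet_abs_le_mul_abs {m : X → ℝ} (hm : Measurable m) (α : ℝ) (h : Lp ℝ 2 μ) :
    MeasurableSet {x | |m x| ≤ α * |h x|} :=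
  measurableSet_le hm.abs ((Lp.stronglyMeasurable h).measurable.abs.const_mul α)

/-- The restriction of `g` to the set where `α |h|` dominates `|m|`. -/
noncomputable def cutoff {m : X → ℝ} (hm : Measurable m) (α : ℝ) (g h : Lp ℝ 2 μ) : Lp ℝ 2 μ :=
  ((Lp.memLp g).indicator (measurableSet_abs_le_mul_abs hm α h)).toLp
    ({x | |m x| ≤ α * |h x|}.indicator g)

theorem coeFn_cutoff {m : X → ℝ} (hm : Measurable m) (α : ℝ) (g h : Lp ℝ 2 μ) :
    cutoff hm α g h =ᵐ[μ] {x | |m x| ≤ α * |h x|}.indicator g :=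
  MemLp.coeFn_toLp _

/-- Vitali's theorem, applied along subsequences on which h → 0 a.e. -/
theorem tendsto_cutoff [IsFiniteMeasure μ] {m : X → ℝ} (hm : Measurable m)
    (hm0 : ∀ᵐ x ∂μ, m x ≠ 0) (α : ℝ) (g : Lp ℝ 2 μ) :
    Tendsto (cutoff hm α g) (𝓝 0) (𝓝 0) := by
  refine tendsto_of_seq_tendsto fun h hh => tendsto_of_subseq_tendsto fun ns hns => ?_
  obtain ⟨ms, -, hms⟩ := (tendstoInMeasure_of_tendsto_Lp (hh.comp hns)).exists_seq_tendsto_ae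
  refine ⟨ms, ?_⟩
  rw [Lp.tendsto_Lp_iff_tendsto_eLpNorm']
  refine tendsto_Lp_finite_of_tendsto_ae one_le_two ENNReal.ofNat_ne_top
    (fun n => Lp.aestronglyMeasurable _) (Lp.memLp 0) ?_ ?_
  -- Uniform integrability: every cutoff is dominated by the fixed function |g|.
  · intro ε hε
    obtain ⟨δ, hδ, hδ'⟩ := (Lp.memLp g).eLpNorm_indicator_le one_le_two ENNReal.ofNat_ne_top hε
    refine ⟨δ, hδ, fun n s hs hμs => (eLpNorm_mono_ae ?_).trans (hδ' s hs hμs)⟩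
    filter_upwards [coeFn_cutoff hm α g (h (ns (ms n)))] with x hx
    by_cases hxs : x ∈ s
    · rw [Set.indicator_of_mem hxs, Set.indicator_of_mem hxs, Function.comp_apply, hx]
      exact norm_indicator_le_norm_self _ _
    · rw [Set.indicator_of_notMem hxs, Set.indicator_of_notMem hxs]
  · have h1 : ∀ᵐ x ∂μ, ∀ n, cutoff hm α g (h (ns (ms n))) x =
        {x | |m x| ≤ α * |h (ns (ms n)) x|}.indicator g x :=
      ae_all_iff.2 fun n => coeFn_cutoff hm α g (h (ns (ms n)))
    filter_upwards [hms, hm0, h1, Lp.coeFn_zero ℝ 2 μ] with x hx hmx h1x h0x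
    rw [h0x, Pi.zero_apply] at hx ⊢
    have h2 := (hx.abs.const_mul α)
    rw [abs_zero, mul_zero] at h2
    refine tendsto_const_nhds.congr' ?_
    -- Since m(x) ≠ 0, the point x eventually leaves the cutoff set.
    filter_upwards [h2.eventually_lt_const (abs_pos.2 hmx)] with n hn
    rw [Function.comp_apply, h1x n, Set.indicator_of_notMem]
    exact not_le.2 hn

end Cutoff

/-! ### First-order expansion of the superposition operator. -/

section StateMap

variable {d : ℕ} {Ω : Set (EuclideanSpace ℝ (Fin d))}
  [IsFiniteMeasure ((volume : Measure (EuclideanSpace ℝ (Fin d))).restrict Ω)]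

/-- The superposition operator `v ↦ min (c, α v + y)` on `L²(Ω)`. -/
noncomputable def stateMap (α c : ℝ) (yd v : L2 Ω) : L2 Ω :=
  Lp.const 2 (volume.restrict Ω) c ⊓ (α • v + yd)

theorem coeFn_stateMap (α c : ℝ) (yd v : L2 Ω) :
    stateMap α c yd v =ᵐ[volume.restrict Ω] fun x => min c (α * v x + yd x) := by
  filter_upwards [Lp.coeFn_inf (Lp.const 2 (volume.restrict Ω) c) (α • v + yd),
    Lp.coeFn_const (p := 2) (μ := volume.restrict Ω) c, Lp.coeFn_add (α • v) yd,
    Lp.coeFn_smul α v] with x h1 h2 h3 h4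
  unfold stateMap
  rw [h1, Pi.inf_apply, h2, h3, Pi.add_apply, h4]
  rfl

theorem continuous_stateMap (α c : ℝ) (yd : L2 Ω) : Continuous (stateMap α c yd) := by
  unfold stateMap
  fun_prop

theorem integralSubdiff_eq {α : ℝ} (hα : 0 < α) (c : ℝ) (yd v : L2 Ω) :
    integralSubdiff α c yd v = {stateMap α c yd v} := by
  ext η
  rw [Set.mem_singleton_iff, Lp.ext_iff]
  have h : η ∈ integralSubdiff α c yd v ↔
      η =ᵐ[volume.restrict Ω] fun x => min c (α * v x + yd x) := by
    refine Filter.eventually_congr (f := ae (volume.restrict Ω)) (Eventually.of_forall fun x => ?_)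
    rw [stateSubdiff_eq_min hα, Set.mem_singleton_iff]
  rw [h]
  exact ⟨fun h => h.trans (coeFn_stateMap α c yd v).symm,
    fun h => h.trans (coeFn_stateMap α c yd v)⟩

omit [IsFiniteMeasure ((volume : Measure (EuclideanSpace ℝ (Fin d))).restrict Ω)] in
theorem coeFn_multiplierOp (α c : ℝ) (yd v h : L2 Ω) :
    multiplierOp α c yd v h =ᵐ[volume.restrict Ω] fun x => multiplierFun α c yd v x * h x :=
  (memLp_multiplier_mul α c yd v h).coeFn_toLp

theorem abs_min_remainder_le {α : ℝ} (hα : 0 ≤ α) (c y z h : ℝ) :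
    |min c (α * (z + h) + y) - min c (α * z + y) - (if c - y < α * z then 0 else α) * h|
      ≤ α * |h| := by
  rw [← abs_of_nonneg hα, ← abs_mul, abs_of_nonneg hα, mul_add]
  split_ifs with h1
  · rw [zero_mul, sub_zero]
    rcases abs_cases (α * h) with h2 | h2 <;> rcases min_cases c (α * z + α * h + y) with h3 | h3 <;>
      rcases min_cases c (α * z + y) with h4 | h4 <;> rw [abs_le] <;> constructor <;> linarith
  · rcases abs_cases (α * h) with h2 | h2 <;> rcases min_cases c (α * z + α * h + y) with h3 | h3 <;>
      rcases min_cases c (α * z + y) with h4 | h4 <;> rw [abs_le] <;> constructor <;> linarith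

/-- So small a perturbation cannot cross the kink, and the minimum is affine on each side of it. -/
theorem min_remainder_eq_zero {α : ℝ} (hα : 0 ≤ α) {c y z h : ℝ}
    (hh : α * |h| < |α * z - (c - y)|) :
    min c (α * (z + h) + y) - min c (α * z + y) - (if c - y < α * z then 0 else α) * h = 0 := by
  rw [← abs_of_nonneg hα, ← abs_mul, abs_of_nonneg hα] at hh
  have h5 := abs_lt.1 hh
  split_ifs with h1
  · rw [abs_of_pos (by linarith)] at h5
    rw [min_eq_left (by linarith), min_eq_left (by linarith)]
    ring
  · rw [abs_of_nonpos (by linarith)] at h5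
    rw [min_eq_right (by linarith), min_eq_right (by linarith)]
    ring

/-- The remainder of the first-order expansion of `stateMap`. -/
noncomputable def stateRemainder (α c : ℝ) (yd v h : L2 Ω) : L2 Ω :=
  stateMap α c yd (v + h) - stateMap α c yd v - multiplierOp α c yd v h

theorem coeFn_stateRemainder (α c : ℝ) (yd v h : L2 Ω) :
    stateRemainder α c yd v h =ᵐ[volume.restrict Ω] fun x =>
      min c (α * (v x + h x) + yd x) - min c (α * v x + yd x) -
        (if c - yd x < α * v x then 0 else α) * h x := by
  filter_upwards [Lp.coeFn_sub (stateMap α c yd (v + h) - stateMap α c yd v)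
      (multiplierOp α c yd v h), Lp.coeFn_sub (stateMap α c yd (v + h)) (stateMap α c yd v),
    coeFn_stateMap α c yd (v + h), coeFn_stateMap α c yd v, coeFn_multiplierOp α c yd v h,
    Lp.coeFn_add v h] with x h1 h2 h3 h4 h5 h6
  unfold stateRemainder
  rw [h1, Pi.sub_apply, h2, Pi.sub_apply, h3, h4, h5, h6]
  rfl

variable {α : ℝ} (hα : 0 ≤ α) (c : ℝ) (yd v : L2 Ω)

omit [IsFiniteMeasure ((volume : Measure (EuclideanSpace ℝ (Fin d))).restrict Ω)] in
theorem measurable_slack (α c : ℝ) (yd v : L2 Ω) :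
    Measurable fun x => α * v x - (c - yd x) :=
  ((Lp.stronglyMeasurable v).measurable.const_mul α).sub
    (measurable_const.sub (Lp.stronglyMeasurable yd).measurable)

include hα in
theorem norm_stateRemainder_le (h : L2 Ω) : ‖stateRemainder α c yd v h‖ ≤ α * ‖h‖ := by
  refine Lp.norm_le_mul_norm_of_ae_le_mul ?_
  filter_upwards [coeFn_stateRemainder α c yd v h] with x hx
  rw [hx]
  exact abs_min_remainder_le hα c (yd x) (v x) (h x)

include hα in
theorem inner_stateRemainder_eq (g h : L2 Ω) :
    inner ℝ g (stateRemainder α c yd v h) =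
      inner ℝ (cutoff (measurable_slack α c yd v) α g h) (stateRemainder α c yd v h) := by
  rw [L2.inner_def, L2.inner_def]
  refine integral_congr_ae ?_
  filter_upwards [coeFn_stateRemainder α c yd v h,
    coeFn_cutoff (measurable_slack α c yd v) α g h] with x hx hx'
  by_cases hmem : x ∈ {x | |α * v x - (c - yd x)| ≤ α * |h x|}
  · rw [hx', Set.indicator_of_mem hmem]
  · rw [hx, min_remainder_eq_zero hα (not_le.1 hmem), inner_zero_right, inner_zero_right]

include hα in
-- With the direction h fixed, h itself is the function cut off, so the estimate is o(t) in norm.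
theorem norm_stateRemainder_smul_le {t : ℝ} (ht : 0 < t) (h : L2 Ω) :
    ‖stateRemainder α c yd v (t • h)‖ ≤
      α * t * ‖cutoff (measurable_slack α c yd v) α h (t • h)‖ := by
  refine Lp.norm_le_mul_norm_of_ae_le_mul ?_
  filter_upwards [coeFn_stateRemainder α c yd v (t • h), Lp.coeFn_smul t h,
    coeFn_cutoff (measurable_slack α c yd v) α h (t • h)] with x hx hs hx'
  rw [hx, hx']
  by_cases hmem : x ∈ {x | |α * v x - (c - yd x)| ≤ α * |(t • h) x|}
  · rw [Set.indicator_of_mem hmem]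
    refine (abs_min_remainder_le hα c (yd x) (v x) ((t • h) x)).trans_eq ?_
    rw [hs, Pi.smul_apply, smul_eq_mul, abs_mul, abs_of_pos ht, Real.norm_eq_abs, mul_assoc]
  · rw [min_remainder_eq_zero hα (not_le.1 hmem), norm_zero]
    positivity

variable (hsc : ∀ᵐ x ∂(volume.restrict Ω), α * v x ≠ c - yd x)

include hα hsc in
theorem eventually_abs_inner_stateRemainder_le (g : L2 Ω) {ε : ℝ} (hε : 0 < ε) :
    ∀ᶠ h in 𝓝 (0 : L2 Ω), |inner ℝ g (stateRemainder α c yd v h)| ≤ ε * ‖h‖ := by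
  have h1 := ((tendsto_cutoff (measurable_slack α c yd v)
    (hsc.mono fun x hx => sub_ne_zero.2 hx) α g).norm.mul_const α)
  rw [norm_zero, zero_mul] at h1
  filter_upwards [h1.eventually_le_const hε] with h hh
  rw [inner_stateRemainder_eq hα]
  calc _ ≤ ‖cutoff (measurable_slack α c yd v) α g h‖ * ‖stateRemainder α c yd v h‖ :=
        abs_real_inner_le_norm _ _
    _ ≤ ‖cutoff (measurable_slack α c yd v) α g h‖ * (α * ‖h‖) := by
        gcongr
        exact norm_stateRemainder_le hα c yd v h
    _ ≤ ε * ‖h‖ := by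
        rw [← mul_assoc]
        gcongr

include hα hsc in
theorem tendsto_stateMap_differenceQuotient (h : L2 Ω) :
    Tendsto (fun t : ℝ => t⁻¹ • (stateMap α c yd (v + t • h) - stateMap α c yd v)) (𝓝[>] 0)
      (𝓝 (multiplierOp α c yd v h)) := by
  have h0 : Tendsto (fun t : ℝ => t • h) (𝓝[>] 0) (𝓝 0) := by
    have h1 : Tendsto (fun t : ℝ => t • h) (𝓝 0) (𝓝 ((0 : ℝ) • h)) := tendsto_id.smul_const h
    rw [zero_smul] at h1
    exact h1.mono_left nhdsWithin_le_nhds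
  have h1 := ((tendsto_cutoff (measurable_slack α c yd v)
    (hsc.mono fun x hx => sub_ne_zero.2 hx) α h).comp h0).norm.const_mul α
  rw [norm_zero, mul_zero] at h1
  rw [tendsto_iff_norm_sub_tendsto_zero]
  refine squeeze_zero' (Eventually.of_forall fun t => norm_nonneg _) ?_ h1
  filter_upwards [self_mem_nhdsWithin] with t ht
  have ht : 0 < t := ht
  have h2 : t⁻¹ • (stateMap α c yd (v + t • h) - stateMap α c yd v) - multiplierOp α c yd v h =
      t⁻¹ • stateRemainder α c yd v (t • h) := by
    unfold stateRemainder
    rw [map_smul, smul_sub _ _ (t • _), inv_smul_smul₀ ht.ne']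
  rw [h2, norm_smul, norm_inv, Real.norm_of_nonneg ht.le, inv_mul_le_iff₀ ht]
  refine (norm_stateRemainder_smul_le hα c yd v ht h).trans_eq ?_
  simp only [Function.comp_apply]
  ring

end StateMap

/-! ### The derivative and coderivative formulas. -/

theorem mainTheorem8 {d : ℕ} (Ω : Set (EuclideanSpace ℝ (Fin d))) (hΩ_open : IsOpen Ω)
    (hΩ_bdd : Bornology.IsBounded Ω) (α c : ℝ) (hα : 0 < α) (yd v η : L2 Ω)
    (hsc : ∀ᵐ x ∂(volume.restrict Ω), α * v x ≠ c - yd x) :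
    (∀ dv : L2 Ω,
      (dv ∈ derivCone v η ∧ η ∈ integralSubdiff α c yd v →
        convexifiedGraphicalDerivative (integralSubdiff α c yd) v η dv =
          {multiplierOp α c yd v dv} + polarCone (derivCone v η)) ∧
      (¬ (dv ∈ derivCone v η ∧ η ∈ integralSubdiff α c yd v) →
        convexifiedGraphicalDerivative (integralSubdiff α c yd) v η dv = ∅)) ∧
    (∀ dη : L2 Ω,
      (-dη ∈ derivCone v η ∧ η ∈ integralSubdiff α c yd v →
        regularCoderivative (integralSubdiff α c yd) v η dη =
          {ContinuousLinearMap.adjoint (multiplierOp α c yd v) dη} + polarCone (derivCone v η)) ∧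
      (¬ (-dη ∈ derivCone v η ∧ η ∈ integralSubdiff α c yd v) →
        regularCoderivative (integralSubdiff α c yd) v η dη = ∅)) ∧
    polarCone (derivCone v η) = {0} := by
  have hfin : IsFiniteMeasure ((volume : Measure (EuclideanSpace ℝ (Fin d))).restrict Ω) :=
    isFiniteMeasure_restrict.2 hΩ_bdd.measure_lt_top.ne
  have hR : integralSubdiff α c yd = fun v => {stateMap α c yd v} :=
    funext (integralSubdiff_eq hα c yd)
  have hS := continuous_stateMap α c yd
  have hweak := fun (g : L2 Ω) (ε : ℝ) (hε : ε > 0) =>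
    eventually_abs_inner_stateRemainder_le hα.le c yd v hsc g hε
  have hdir := tendsto_stateMap_differenceQuotient hα.le c yd v hsc
  have hpolar : polarCone (derivCone v η) = {0} := polarCone_univ
  rw [hpolar, hR]
  refine ⟨fun dv => ⟨?_, fun hn => ?_⟩, fun dη => ⟨?_, fun hn => ?_⟩, rfl⟩
  · rintro ⟨-, rfl⟩
    rw [convexifiedGraphicalDerivative_singleton hweak hdir, Set.singleton_add_singleton,
      add_zero]
  · exact convexifiedGraphicalDerivative_eq_empty (isClosed_setValuedGraph_singleton hS)
      (fun hη => hn ⟨Set.mem_univ _, hη⟩) dv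
  · rintro ⟨-, rfl⟩
    rw [regularCoderivative_singleton hweak hdir, Set.singleton_add_singleton, add_zero]
  · exact regularCoderivative_eq_empty (R := fun v => {stateMap α c yd v})
      (fun hη => hn ⟨Set.mem_univ _, hη⟩) dη
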